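/- A $\ast$-ring is an associative unital ring with involution. A quadratic module in a $\ast$-ring $R$ is a set $M\subseteq\{r\in R: r=r^\ast\}$ with $1\in M$, $M+M\subseteq M$ and $rMr^\ast\subseteq M$ for all $r\in R$; it is proper if $-1\notin M$. The ring $R$ is called real if it has a proper quadratic module $M$ with $M\cap -M=\{0\}$. Let $R$ be a real Noetherian $\ast$-ring that is prime (if $aRb=0$, then $a=0$ or $b=0$) or, more generally, $\ast$-prime ($R\neq 0$, and any two $\ast$-invariant two-sided ideals $I,J$ with $IJ=0$ satisfy $I=0$ or $J=0$). Let $N$ be the set of all elements of $R$ that are neither left nor right zero divisors. Then $N$ is a $\ast$-invariant two-sided Ore set, and the ring of fractions $Q=RN^{-1}$ (the Goldie ring of fractions of $R$) is isomorphic as a ring to $M_n(D)$ for some integer $n\ge 1$ and some skew field $D$. Moreover, the involution of $R$ extends uniquely to an involution of $Q$, and with this involution $Q$ is not $\ast$-isomorphic to any ring $M_m(E)\oplus M_m(E)^{op}$ with $E$ a skew field and the exchange involution $(a,b)^\ast=(b,a)$. -/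

import Mathlib

universe u v

/-- A quadratic module in a `*`-ring `R`: a set `M` of symmetric elements with `1 ∈ M`,
`M + M ⊆ M` and `r M r* ⊆ M` for every `r`. -/
structure IsQuadraticModule {R : Type*} [Ring R] [StarRing R] (M : Set R) : Prop where
  star_eq : ∀ x ∈ M, star x = x
  one_mem : 1 ∈ M
  add_mem : ∀ x ∈ M, ∀ y ∈ M, x + y ∈ M
  conj_mem : ∀ r : R, ∀ x ∈ M, r * x * star r ∈ M

/-- A quadratic module is proper if it does not contain `-1`. -/
def IsProperQuadraticModule {R : Type*} [Ring R] [StarRing R] (M : Set R) : Prop :=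
  IsQuadraticModule M ∧ (-1 : R) ∉ M

/-- The support `M ∩ -M`. -/
def quadraticSupport {R : Type*} [Ring R] (M : Set R) : Set R :=
  {x | x ∈ M ∧ -x ∈ M}

/-- A `*`-ring is real if it has a (proper) quadratic module with support zero. -/
def IsRealStarRing (R : Type*) [Ring R] [StarRing R] : Prop :=
  ∃ M : Set R, IsProperQuadraticModule M ∧ quadraticSupport M = {0}

/-- A (nonzero) ring is prime if `a R b = 0` implies `a = 0` or `b = 0`. -/
def IsPrimeRing (R : Type*) [Ring R] : Prop :=
  Nontrivial R ∧ ∀ a b : R, (∀ r : R, a * r * b = 0) → a = 0 ∨ b = 0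

/-- A (nonzero) `*`-ring is `*`-prime if the product of two nonzero `*`-invariant two-sided
ideals is never zero. -/
def IsStarPrimeRing (R : Type*) [Ring R] [StarRing R] : Prop :=
  Nontrivial R ∧ ∀ I J : TwoSidedIdeal R, (∀ x ∈ I, star x ∈ I) → (∀ x ∈ J, star x ∈ J) →
    (∀ x ∈ I, ∀ y ∈ J, x * y = 0) → I = ⊥ ∨ J = ⊥

/-- Every prime `*`-ring is `*`-prime. -/
theorem IsPrimeRing.isStarPrimeRing {R : Type*} [Ring R] [StarRing R] (h : IsPrimeRing R) :
    IsStarPrimeRing R := by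
  refine ⟨h.1, fun I J _ _ hIJ => ?_⟩
  by_contra hne
  rw [not_or] at hne
  obtain ⟨hI, hJ⟩ := hne
  have key : ∀ K : TwoSidedIdeal R, K ≠ ⊥ → ∃ x ∈ K, x ≠ 0 := by
    intro K hK
    by_contra hcon
    push Not at hcon
    exact hK (le_bot_iff.mp fun x hx => (TwoSidedIdeal.mem_bot R).mpr (hcon x hx))
  obtain ⟨a, ha, ha0⟩ := key I hI
  obtain ⟨b, hb, hb0⟩ := key J hJ
  exact (h.2 a b fun r => hIJ _ (I.mul_mem_right a r ha) _ hb).elim ha0 hb0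

/-- The ring `A ⊕ Aᵒᵖ`, to be equipped with the exchange involution. -/
def ExchangeRing (A : Type*) : Type _ := A × Aᵐᵒᵖ

instance ExchangeRing.instRing (A : Type*) [Ring A] : Ring (ExchangeRing A) :=
  inferInstanceAs (Ring (A × Aᵐᵒᵖ))

/-- The exchange involution `(a, b)* = (b, a)` on `A ⊕ Aᵒᵖ`. -/
instance ExchangeRing.instStarRing (A : Type*) [Ring A] : StarRing (ExchangeRing A) where
  star x := (MulOpposite.unop x.2, MulOpposite.op x.1)
  star_involutive _ := rfl
  star_mul _ _ := rfl
  star_add _ _ := rfl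

/-! Realness enters twice, both times as: `a * star a + b * star b = 0` forces both summands to
vanish. It first upgrades `*`-prime to prime (`IsStarPrimeRing.isPrimeRing`). The involution is an
isomorphism onto the opposite ring, so `R` is Noetherian on both sides and Goldie's theorem applies:
essential left ideals contain regular elements. This gives the left Ore condition, and the
involution turns it into the right one. In `Q` regular elements are units, so an essential left
ideal is everything; simplicity and semisimplicity follow, and Wedderburn–Artin gives matrices over
a skew field. Finally, `q * star q = -1` in `Q` would, after clearing denominators, be a vanishing
sum of hermitian squares in `R`, whereas in an exchange ring `(1, -1)` is such a `q`. -/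

/-! ### Real `*`-prime rings are prime. -/

section RealStarPrime

variable {R : Type*} [Ring R] [StarRing R]

/-- In a real `*`-ring, a sum of two hermitian squares vanishes only if the summands do. -/
theorem IsRealStarRing.mul_star_self_eq_zero (hR : IsRealStarRing R) {a b : R}
    (h : a * star a + b * star b = 0) : a * star a = 0 := by
  obtain ⟨M, ⟨hM, -⟩, hsupp⟩ := hR
  have hsq (r : R) : r * star r ∈ M := by simpa using hM.conj_mem r 1 hM.one_mem
  have : a * star a ∈ quadraticSupport M := by
    refine ⟨hsq a, ?_⟩
    rw [neg_eq_of_add_eq_zero_right h]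
    exact hsq b
  simpa [hsupp] using this

/-- `I ∩ I*` is `*`-invariant of square zero, hence zero. It contains `I I*` and `I* I`, so `I + I*`
also has square zero and vanishes. -/
theorem IsStarPrimeRing.eq_zero_of_nilpotent_ideal (hR : IsStarPrimeRing R) {I : TwoSidedIdeal R}
    (hI : ∀ x ∈ I, ∀ y ∈ I, x * y = 0) : ∀ x ∈ I, x = 0 := by
  -- the ideal `I ⊓ star I` has square zero
  let J : TwoSidedIdeal R := TwoSidedIdeal.mk' {x | x ∈ I ∧ star x ∈ I}
    ⟨I.zero_mem, by simp [I.zero_mem]⟩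
    (fun hx hy => ⟨I.add_mem hx.1 hy.1, by simpa using I.add_mem hx.2 hy.2⟩)
    (fun hx => ⟨I.neg_mem hx.1, by simpa using I.neg_mem hx.2⟩)
    (fun {x y} hy => ⟨I.mul_mem_left x y hy.1, by simpa using I.mul_mem_right _ (star x) hy.2⟩)
    (fun {x y} hx => ⟨I.mul_mem_right x y hx.1, by simpa using I.mul_mem_left (star y) _ hx.2⟩)
  have memJ {x : R} : x ∈ J ↔ x ∈ I ∧ star x ∈ I := by simp [J, TwoSidedIdeal.mem_mk']
  have hJ {x : R} (h1 : x ∈ I) (h2 : star x ∈ I) : x = 0 := by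
    have hbot : J = ⊥ := by
      have hst : ∀ x ∈ J, star x ∈ J := fun x hx =>
        memJ.2 ⟨(memJ.1 hx).2, by simpa using (memJ.1 hx).1⟩
      exact (hR.2 J J hst hst fun x hx y hy => hI x (memJ.1 hx).1 y (memJ.1 hy).1).elim id id
    have : x ∈ J := memJ.2 ⟨h1, h2⟩
    rwa [hbot, TwoSidedIdeal.mem_bot] at this
  -- the ideal `I + star I` has square zero as well
  let K : TwoSidedIdeal R := TwoSidedIdeal.mk' {x | ∃ y ∈ I, ∃ z ∈ I, x = y + star z}
    ⟨0, I.zero_mem, 0, I.zero_mem, by simp⟩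
    (by
      rintro _ _ ⟨a, ha, b, hb, rfl⟩ ⟨c, hc, d, hd, rfl⟩
      exact ⟨a + c, I.add_mem ha hc, b + d, I.add_mem hb hd, by rw [star_add]; abel⟩)
    (by
      rintro _ ⟨a, ha, b, hb, rfl⟩
      exact ⟨-a, I.neg_mem ha, -b, I.neg_mem hb, by rw [star_neg]; abel⟩)
    (by
      rintro x _ ⟨a, ha, b, hb, rfl⟩
      exact ⟨x * a, I.mul_mem_left _ _ ha, b * star x, I.mul_mem_right _ _ hb, by
        simp [mul_add]⟩)
    (by
      rintro _ y ⟨a, ha, b, hb, rfl⟩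
      exact ⟨a * y, I.mul_mem_right _ _ ha, star y * b, I.mul_mem_left _ _ hb, by
        simp [add_mul]⟩)
  have memK {x : R} : x ∈ K ↔ ∃ y ∈ I, ∃ z ∈ I, x = y + star z := by
    simp [K, TwoSidedIdeal.mem_mk']
  have hst : ∀ x ∈ K, star x ∈ K := by
    intro x hx
    obtain ⟨a, ha, b, hb, rfl⟩ := memK.1 hx
    exact memK.2 ⟨b, hb, a, ha, by simp [add_comm]⟩
  have hKK : ∀ x ∈ K, ∀ y ∈ K, x * y = 0 := by
    intro x hx y hy
    obtain ⟨a, ha, b, hb, rfl⟩ := memK.1 hx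
    obtain ⟨c, hc, d, hd, rfl⟩ := memK.1 hy
    have h1 : a * star d = 0 :=
      hJ (I.mul_mem_right _ _ ha) (by simpa using I.mul_mem_right _ (star a) hd)
    have h2 : star b * c = 0 :=
      hJ (I.mul_mem_left _ _ hc) (by simpa using I.mul_mem_left (star c) _ hb)
    have h3 : star b * star d = 0 := by rw [← star_mul, hI d hd b hb, star_zero]
    rw [mul_add, add_mul, add_mul, hI a ha c hc, h1, h2, h3]
    simp
  have hK : K = ⊥ := (hR.2 K K hst hst hKK).elim id id
  intro x hx
  have : x ∈ K := memK.2 ⟨x, hx, 0, I.zero_mem, by simp⟩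
  rwa [hK, TwoSidedIdeal.mem_bot] at this

/-- A `*`-prime ring is semiprime. -/
theorem IsStarPrimeRing.eq_zero_of_forall_mul_mul_self (hR : IsStarPrimeRing R) {a : R}
    (ha : ∀ r, a * r * a = 0) : a = 0 := by
  refine hR.eq_zero_of_nilpotent_ideal (I := TwoSidedIdeal.span {a}) ?_ a
    (TwoSidedIdeal.subset_span rfl)
  have h1 : ∀ y ∈ TwoSidedIdeal.span {a}, ∀ r, a * r * y = 0 := by
    intro y hy
    induction hy using TwoSidedIdeal.span_induction with
    | mem x h => rw [Set.mem_singleton_iff.1 h]; exact ha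
    | zero => simp
    | add x y _ _ hx hy => intro r; rw [mul_add, hx, hy, add_zero]
    | neg x _ hx => intro r; rw [mul_neg, hx, neg_zero]
    | left_absorb b x _ hx => intro r; simpa [mul_assoc] using hx (r * b)
    | right_absorb b x _ hx => intro r; rw [← mul_assoc, hx, zero_mul]
  intro x hx
  induction hx using TwoSidedIdeal.span_induction with
  | mem x h =>
    rw [Set.mem_singleton_iff.1 h]
    intro y hy
    simpa using h1 y hy 1
  | zero => simp
  | add x y _ _ hx hy => intro z hz; rw [add_mul, hx z hz, hy z hz, add_zero]
  | neg x _ hx => intro z hz; rw [neg_mul, hx z hz, neg_zero]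
  | left_absorb b x _ hx => intro z hz; rw [mul_assoc, hx z hz, mul_zero]
  | right_absorb b x _ hx =>
    intro z hz; rw [mul_assoc, hx _ (TwoSidedIdeal.mul_mem_left _ _ _ hz)]

/-- If `a R b = 0` and `b ≠ 0`, the annihilator `I` of `R b` satisfies `I ∩ I* = 0`: that ideal and
its right annihilator, which contains `b`, are `*`-invariant with product zero. Realness then makes
every element of `I` square to zero, and semiprimeness kills `I`. -/
theorem IsStarPrimeRing.isPrimeRing (hR : IsStarPrimeRing R) (hreal : IsRealStarRing R) :
    IsPrimeRing R := by
  refine ⟨hR.1, fun a b hab => or_iff_not_imp_right.2 fun hb => ?_⟩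
  let I : Set R := {x | ∀ r, x * r * b = 0}
  have Iadd {x y : R} (hx : x ∈ I) (hy : y ∈ I) : x + y ∈ I := fun r => by
    rw [add_mul, add_mul, hx, hy, add_zero]
  have Ineg {x : R} (hx : x ∈ I) : -x ∈ I := fun r => by
    rw [neg_mul, neg_mul, hx, neg_zero]
  have Ileft (r : R) {x : R} (hx : x ∈ I) : r * x ∈ I := fun s => by
    rw [mul_assoc, mul_assoc, ← mul_assoc x, hx, mul_zero]
  have Iright {x : R} (r : R) (hx : x ∈ I) : x * r ∈ I := fun s => by
    rw [mul_assoc x]; exact hx _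
  let L : TwoSidedIdeal R := TwoSidedIdeal.mk' {x | x ∈ I ∧ star x ∈ I}
    (by simp [I])
    (fun hx hy => ⟨Iadd hx.1 hy.1, by simpa using Iadd hx.2 hy.2⟩)
    (fun hx => ⟨Ineg hx.1, by simpa using Ineg hx.2⟩)
    (fun {x y} hy => ⟨Ileft x hy.1, by simpa using Iright (star x) hy.2⟩)
    (fun {x y} hx => ⟨Iright y hx.1, by simpa using Ileft (star y) hx.2⟩)
  have memL {x : R} : x ∈ L ↔ x ∈ I ∧ star x ∈ I := by simp [L, TwoSidedIdeal.mem_mk']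
  have Lstar : ∀ x ∈ L, star x ∈ L := fun x hx =>
    memL.2 ⟨(memL.1 hx).2, by simpa using (memL.1 hx).1⟩
  let J : TwoSidedIdeal R := TwoSidedIdeal.mk' {y | ∀ x ∈ L, x * y = 0}
    (by simp)
    (fun hx hy z hz => by rw [mul_add, hx z hz, hy z hz, add_zero])
    (fun hx z hz => by rw [mul_neg, hx z hz, neg_zero])
    (fun {x y} hy z hz => by rw [← mul_assoc, hy _ (L.mul_mem_right _ _ hz)])
    (fun {x y} hx z hz => by rw [← mul_assoc, hx z hz, zero_mul])
  have memJ {y : R} : y ∈ J ↔ ∀ x ∈ L, x * y = 0 := by simp [J, TwoSidedIdeal.mem_mk']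
  have Jstar : ∀ y ∈ J, star y ∈ J := by
    refine fun y hy => memJ.2 fun x hx => ?_
    -- `L` annihilates `y` from the left, so semiprimeness makes `y` annihilate `L` from the left
    -- too.
    have : y * star x = 0 := hR.eq_zero_of_forall_mul_mul_self fun r => by
      have h := memJ.1 hy _ (L.mul_mem_right _ r (Lstar x hx))
      rw [mul_assoc y, mul_assoc y, ← mul_assoc _ y, h, zero_mul, mul_zero]
    simpa using congrArg star this
  have hbJ : b ∈ J := memJ.2 fun x hx => by simpa using (memL.1 hx).1 1
  have hL : L = ⊥ := (hR.2 L J Lstar Jstar fun x hx y hy => memJ.1 hy x hx).resolve_right fun h =>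
    hb (by rwa [h, TwoSidedIdeal.mem_bot] at hbJ)
  have hI {x : R} (h1 : x ∈ I) (h2 : star x ∈ I) : x = 0 := by
    have : x ∈ L := memL.2 ⟨h1, h2⟩
    rwa [hL, TwoSidedIdeal.mem_bot] at this
  have hsq {x : R} (hx : x ∈ I) : x * x = 0 := by
    have h1 : x * star x = 0 := hI (Iright _ hx) (by simpa using Iright _ hx)
    have h2 : star x * x = 0 := hI (Ileft _ hx) (by simpa using Ileft _ hx)
    have h3 : x * x + star x * star x = 0 := by
      -- The two hermitian squares add up to `2 (x x* + x* x) = 0`, so `(x + x*)² = 0`.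
      have := hreal.mul_star_self_eq_zero (a := x + star x) (b := x - star x) (by
        simp [mul_add, add_mul, mul_sub, sub_mul, h1, h2])
      simpa [mul_add, add_mul, h1, h2, add_comm] using this
    refine hI (Ileft _ hx) ?_
    rw [star_mul, ← neg_eq_of_add_eq_zero_right h3]
    exact Ineg (Ileft _ hx)
  refine hR.eq_zero_of_forall_mul_mul_self fun r => ?_
  -- Expanding `(a + r a)² = 0` leaves only `a r a`.
  have ha : a ∈ I := hab
  have h := hsq (Iadd ha (Ileft r ha))
  rw [mul_add, add_mul, add_mul, hsq ha, hsq (Ileft r ha), mul_assoc r, hsq ha] at h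
  simpa [mul_assoc] using h

end RealStarPrime

/-! ### Goldie's lemma and the Ore condition. -/

section Goldie

variable {R : Type*} [Ring R]

/-- A left ideal is essential if it meets every nonzero left ideal nontrivially. -/
def Ideal.IsEssential (E : Ideal R) : Prop :=
  ∀ x ≠ 0, ∃ r, r * x ≠ 0 ∧ r * x ∈ E

theorem Ideal.IsEssential.mono {E F : Ideal R} (hE : E.IsEssential) (h : E ≤ F) :
    F.IsEssential := fun x hx =>
  let ⟨r, hr, hr'⟩ := hE x hx
  ⟨r, hr, h hr'⟩

/-- The preimage of an essential left ideal under right multiplication is essential. -/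
theorem Ideal.IsEssential.comap_mulRight {E : Ideal R} (hE : E.IsEssential) (a : R) :
    Ideal.IsEssential (Submodule.comap (LinearMap.toSpanSingleton R R a) E) := by
  intro y hy
  by_cases h : y * a = 0
  · exact ⟨1, by simpa, by simp [h]⟩
  · obtain ⟨r, hr, hr'⟩ := hE _ h
    exact ⟨r, fun h0 => hr (by rw [← mul_assoc, h0, zero_mul]), by simpa [mul_assoc] using hr'⟩

theorem IsPrimeRing.eq_zero_of_forall_mul_mul_self (hR : IsPrimeRing R) {a : R}
    (ha : ∀ r, a * r * a = 0) : a = 0 :=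
  (hR.2 a a ha).elim id id

/-- The left singular ideal of a prime left Noetherian ring is zero. -/
theorem IsPrimeRing.eq_zero_of_isEssential_torsionOf [IsNoetherianRing R] (hR : IsPrimeRing R)
    {a : R} (ha : (Ideal.torsionOf R R a).IsEssential) : a = 0 := by
  by_contra ha0
  -- Take `b` with maximal annihilator. If `b r b ≠ 0`, essentiality yields `x` with `x b ≠ 0` and
  -- `x b r b = 0`, so the annihilator of `b r b` is strictly larger.
  obtain ⟨_, ⟨b, hb0, hb, rfl⟩, hmax⟩ := set_has_maximal_iff_noetherian.2 ‹IsNoetherianRing R›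
    {I : Ideal R | ∃ b ≠ 0, (Ideal.torsionOf R R b).IsEssential ∧ I = Ideal.torsionOf R R b}
    ⟨_, a, ha0, ha, rfl⟩
  refine hb0 (hR.eq_zero_of_forall_mul_mul_self fun r => ?_)
  by_contra h
  have hle : Ideal.torsionOf R R b ≤ Ideal.torsionOf R R (b * r * b) := fun x hx => by
    rw [Ideal.mem_torsionOf_iff, smul_eq_mul] at hx ⊢
    rw [← mul_assoc, ← mul_assoc, hx, zero_mul, zero_mul]
  obtain ⟨x, hx, hx'⟩ := hb.comap_mulRight r b hb0
  refine hmax _ ⟨_, h, hb.mono hle, rfl⟩ (lt_of_le_not_ge hle fun hge => hx ?_)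
  refine hge ?_
  simpa [mul_assoc] using hx'

/-- A nonzero left ideal of a prime left Noetherian ring contains an element `b` with `b * b ≠ 0`
and `R b ∩ ann b = 0`. -/
theorem IsPrimeRing.exists_mem_mul_self_ne_zero [IsNoetherianRing R] (hR : IsPrimeRing R)
    {I : Ideal R} (hI : I ≠ ⊥) :
    ∃ b ∈ I, b ≠ 0 ∧ ∀ x, x * b * b = 0 → x * b = 0 := by
  obtain ⟨a, ha, ha0⟩ := Submodule.exists_mem_ne_zero_of_ne_bot hI
  -- some `r * a` is not nilpotent
  have key : ∃ r, ¬ IsNilpotent (r * a) := by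
    by_contra! hnil
    -- Take `u ∈ a R` nonzero with maximal left annihilator. The last nonzero power of the nilpotent
    -- `v = u r` lies in `u R`, so it has the same annihilator as `u`. Since `v` kills it, `u r u =
    -- 0`.
    obtain ⟨_, ⟨u, hu0, ⟨s, rfl⟩, rfl⟩, hmax⟩ :=
      set_has_maximal_iff_noetherian.2 ‹IsNoetherianRing R›
      {I : Ideal R | ∃ u ≠ 0, (∃ s, u = a * s) ∧ I = Ideal.torsionOf R R u}
      ⟨_, a, ha0, ⟨1, by simp⟩, rfl⟩
    refine hu0 (hR.eq_zero_of_forall_mul_mul_self fun r => ?_)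
    by_contra hne
    have hnilp : IsNilpotent (a * (s * r)) := by
      obtain ⟨n, hn⟩ := hnil (s * r)
      refine ⟨n + 1, ?_⟩
      have := mul_pow_mul a (s * r) n
      rw [pow_succ, ← mul_assoc, this, hn]
      simp
    set v := a * (s * r) with hv
    have hvu : v = a * s * r := (mul_assoc a s r).symm
    have hv0 : v ≠ 0 := by
      intro h
      rw [← hvu, h, zero_mul] at hne
      exact hne rfl
    classical
    have hfind := Nat.find_spec hnilp
    obtain ⟨m, hm⟩ : ∃ m, Nat.find hnilp = m + 2 := by
      match h : Nat.find hnilp with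
      | 0 =>
        rw [h, pow_zero] at hfind
        exact (hv0 (by rw [← mul_one v, hfind, mul_zero])).elim
      | 1 => exact (hv0 (by rwa [h, pow_one] at hfind)).elim
      | m + 2 => exact ⟨m, rfl⟩
    have hw0 : v ^ (m + 1) ≠ 0 := Nat.find_min hnilp (by omega)
    rw [hm] at hfind
    have hw : v ^ (m + 1) = a * s * (r * v ^ m) := by rw [pow_succ', hvu, mul_assoc (a * s)]
    have hle : Ideal.torsionOf R R (a * s) ≤ Ideal.torsionOf R R (v ^ (m + 1)) := fun x hx => by
      rw [Ideal.mem_torsionOf_iff, smul_eq_mul] at hx ⊢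
      rw [hw, ← mul_assoc, hx, zero_mul]
    refine hmax _ ⟨_, hw0, ⟨s * (r * v ^ m), by rw [hw, mul_assoc a]⟩, rfl⟩
      (lt_of_le_not_ge hle fun hge => hne ?_)
    rw [← hvu]
    exact hge (show v * v ^ (m + 1) = 0 by rw [← pow_succ', hfind])
  obtain ⟨r, hr⟩ := key
  set c := r * a
  have hcI : c ∈ I := I.mul_mem_left r ha
  have hc (n : ℕ) : c ^ n ≠ 0 := fun h => hr ⟨n, h⟩
  obtain ⟨n, hn⟩ := monotone_stabilizes_iff_noetherian.2 ‹IsNoetherianRing R›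
    ⟨fun n => Ideal.torsionOf R R (c ^ n), monotone_nat_of_le_succ fun n x hx => by
      rw [Ideal.mem_torsionOf_iff, smul_eq_mul] at hx ⊢
      rw [pow_succ, ← mul_assoc, hx, zero_mul]⟩
  -- Stabilization gives `ann b = ann b²` for `b = c ^ (n + 1)`; the extra factor keeps `b` in `I`
  -- even when `n = 0`.
  refine ⟨c ^ (n + 1), pow_succ c n ▸ I.mul_mem_left _ hcI, hc _, fun x hx => ?_⟩
  have h : Ideal.torsionOf R R (c ^ (n + 1)) = Ideal.torsionOf R R (c ^ (n + 1 + (n + 1))) :=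
    (hn _ (by omega)).symm.trans (hn _ (by omega))
  have hmem : x ∈ Ideal.torsionOf R R (c ^ (n + 1)) := by
    rw [h, Ideal.mem_torsionOf_iff, smul_eq_mul, pow_add, ← mul_assoc, hx]
  exact hmem

/-- An element with zero left annihilator in a left Noetherian ring generates an essential left
ideal. -/
theorem Ideal.isEssential_span_singleton [IsNoetherianRing R] {c : R}
    (hc : ∀ x, x * c = 0 → x = 0) : (Ideal.span {c}).IsEssential := by
  intro y hy
  by_contra! h
  -- If `R c ∩ R y = 0`, then `R × R y` embeds in `R` because `R c ≅ R`; Noetherianity forces `R y =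
  -- 0`.
  let f : R × Ideal.span {y} →ₗ[R] R :=
    (LinearMap.toSpanSingleton R R c).coprod (Ideal.span {y}).subtype
  have hf : Function.Injective f := by
    rw [← LinearMap.ker_eq_bot, LinearMap.ker_eq_bot']
    rintro ⟨x, ⟨z, hz⟩⟩ hxz
    obtain ⟨r, rfl⟩ := Ideal.mem_span_singleton'.1 hz
    have hxz' : x * c + r * y = 0 := hxz
    have hry : r * y = 0 := by
      by_contra hne
      refine h r hne (Ideal.mem_span_singleton'.2 ⟨-x, ?_⟩)
      rw [neg_mul, neg_eq_of_add_eq_zero_right hxz']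
    rw [hry, add_zero] at hxz'
    simp [hc x hxz', hry]
  have := IsNoetherian.subsingleton_of_prod_injective f hf
  exact hy (congrArg Subtype.val
    (Subsingleton.elim (⟨y, Ideal.mem_span_singleton_self y⟩ : Ideal.span {y}) 0))

/-- If `c x = 0`, the left annihilator of `x` contains the essential ideal `R c`, so `x` lies in the
singular ideal, which is zero. -/
theorem IsPrimeRing.mem_nonZeroDivisors [IsNoetherianRing R] (hR : IsPrimeRing R) {c : R}
    (hc : ∀ x, x * c = 0 → x = 0) : c ∈ nonZeroDivisors R := by
  refine ⟨fun x hx => hR.eq_zero_of_isEssential_torsionOf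
    ((Ideal.isEssential_span_singleton hc).mono ?_), hc⟩
  rw [Ideal.span_singleton_le_iff_mem]
  exact hx

/-- **Goldie's lemma**: an essential left ideal of a prime Noetherian ring contains a regular
element. -/
theorem IsPrimeRing.exists_mem_nonZeroDivisors [IsNoetherianRing R] [IsNoetherianRing Rᵐᵒᵖ]
    (hR : IsPrimeRing R) {E : Ideal R} (hE : E.IsEssential) : ∃ c ∈ E, c ∈ nonZeroDivisors R := by
  -- right annihilator of the left annihilator of `c`
  let K (c : R) : Ideal Rᵐᵒᵖ :=
    { carrier := {y | ∀ x, x * c = 0 → x * y.unop = 0}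
      add_mem' := fun ha hb x hx => by
        rw [MulOpposite.unop_add, mul_add, ha x hx, hb x hx, add_zero]
      zero_mem' := by simp
      smul_mem' := fun r y hy x hx => by
        rw [smul_eq_mul, MulOpposite.unop_mul, ← mul_assoc, hy x hx, zero_mul] }
  -- Choose `c` with `K c` maximal. If `ann c ≠ 0`, it meets `E`, and a suitable `b` there gives
  -- `ann (b + c) = ann b ∩ ann c`. Then `b + c` is again admissible with strictly larger `K`, since
  -- `b + c ∈ K c` would give `b² = 0`.
  obtain ⟨_, ⟨c, hcE, hc, rfl⟩, hmax⟩ :=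
    set_has_maximal_iff_noetherian.2 ‹IsNoetherianRing Rᵐᵒᵖ›
    {I : Ideal Rᵐᵒᵖ | ∃ c ∈ E, (∀ x, x * c * c = 0 → x * c = 0) ∧ I = K c}
    ⟨_, 0, E.zero_mem, by simp, rfl⟩
  refine ⟨c, hcE, hR.mem_nonZeroDivisors ?_⟩
  by_contra! ⟨y, hy, hy0⟩
  have hne : Ideal.torsionOf R R c ⊓ E ≠ ⊥ := by
    obtain ⟨r, hr, hrE⟩ := hE y hy0
    refine (Submodule.ne_bot_iff _).2 ⟨r * y, ⟨?_, hrE⟩, hr⟩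
    simp [mul_assoc, hy]
  obtain ⟨b, ⟨hbc, hbE⟩, hb0, hb⟩ := hR.exists_mem_mul_self_ne_zero hne
  replace hbc : b * c = 0 := hbc
  have hsum {x : R} (hx : x * (b + c) = 0) : x * b = 0 ∧ x * c = 0 := by
    rw [mul_add] at hx
    have h1 : x * c = 0 := hc x (by
      have := congrArg (· * c) hx
      simpa [add_mul, mul_assoc, hbc] using this)
    exact ⟨by simpa [h1] using hx, h1⟩
  refine hmax (K (b + c)) ⟨b + c, E.add_mem hbE hcE, fun x hx => ?_, rfl⟩ ?_
  · obtain ⟨h1, h2⟩ := hsum hx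
    have h3 : x * c = 0 := hc x (by simpa [mul_add, add_mul, mul_assoc, hbc] using h2)
    rw [mul_add, h3, add_zero] at h1 ⊢
    exact hb x h1
  · refine lt_of_le_not_ge (fun z hz x hx => hz x (hsum hx).2) fun hge => ?_
    have h1 : MulOpposite.op (b + c) ∈ K c := hge fun x hx => hx
    have h2 : b * (b + c) = 0 := h1 b hbc
    refine hb0 ?_
    have := hb 1 (by rw [one_mul]; exact (hsum h2).1)
    simpa using this

/-- The left Ore condition. -/
theorem IsPrimeRing.exists_mul_eq_mul [IsNoetherianRing R] [IsNoetherianRing Rᵐᵒᵖ]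
    (hR : IsPrimeRing R) (r : R) (s : nonZeroDivisors R) :
    ∃ (r' : R) (s' : nonZeroDivisors R), (s' : R) * r = r' * s := by
  obtain ⟨c, hc, hc'⟩ := hR.exists_mem_nonZeroDivisors
    ((Ideal.isEssential_span_singleton s.2.2).comap_mulRight r)
  obtain ⟨r', hr'⟩ := Ideal.mem_span_singleton'.1 (Submodule.mem_comap.1 hc)
  exact ⟨r', ⟨c, hc'⟩, by simpa using hr'.symm⟩

theorem IsPrimeRing.nonempty_oreSet [IsNoetherianRing R] [IsNoetherianRing Rᵐᵒᵖ]
    (hR : IsPrimeRing R) : Nonempty (OreLocalization.OreSet (nonZeroDivisors R)) := by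
  choose f g h using hR.exists_mul_eq_mul
  refine ⟨⟨fun r₁ r₂ s hs => ⟨1, ?_⟩, f, g, h⟩⟩
  rw [← sub_eq_zero, ← mul_sub]
  rw [← sub_eq_zero, ← sub_mul] at hs
  simp [s.2.2 _ hs]

end Goldie

/-! ### The ring of fractions: structure and involution. -/

section Fractions

variable {R Q : Type*} [Ring R] [Ring Q]

/-- The ring homomorphism `ι` exhibits `Q` as the left ring of fractions of `R` with respect to its
regular elements. -/
structure IsLeftQuotientMap (ι : R →+* Q) : Prop where
  injective : Function.Injective ι
  isUnit : ∀ s ∈ nonZeroDivisors R, IsUnit (ι s)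
  surj : ∀ q : Q, ∃ s ∈ nonZeroDivisors R, ∃ r : R, ι s * q = ι r

theorem OreLocalization.isLeftQuotientMap (R : Type*) [Ring R]
    [OreLocalization.OreSet (nonZeroDivisors R)] :
    IsLeftQuotientMap (OreLocalization.numeratorRingHom (R := R) (S := nonZeroDivisors R)) where
  injective := OreLocalization.numeratorHom_inj fun _ h => h.1
  isUnit s hs := OreLocalization.numerator_isUnit ⟨s, hs⟩
  surj q := by
    induction q using OreLocalization.ind with | _ r s
    exact ⟨s, s.2, r, OreLocalization.mul_cancel⟩

namespace IsLeftQuotientMap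

variable {ι : R →+* Q} (hι : IsLeftQuotientMap ι)
include hι

theorem ringHom_ext {T : Type*} [Ring T] {f g : Q →+* T} (h : ∀ r, f (ι r) = g (ι r)) : f = g := by
  ext q
  obtain ⟨s, hs, r, hr⟩ := hι.surj q
  have h1 : f (ι s) * f q = f (ι s) * g q := by
    rw [← map_mul, hr, h r, h s, ← map_mul, hr]
  exact ((hι.isUnit s hs).map f).mul_left_cancel h1

/-- A left ideal of `Q` is generated by its numerators, since `q = s⁻¹ r`; contraction to `R` is
therefore an order embedding. -/
theorem ideal_le_of_comap_le {L L' : Ideal Q} (h : L.comap ι ≤ L'.comap ι) : L ≤ L' := by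
  intro q hq
  obtain ⟨s, hs, r, hr⟩ := hι.surj q
  have h1 : ι r ∈ L' := h (show ι r ∈ L by rw [← hr]; exact L.mul_mem_left _ hq)
  obtain ⟨u, hu⟩ := hι.isUnit s hs
  have h2 : q = ↑u⁻¹ * ι r := by rw [← hr, ← hu, Units.inv_mul_cancel_left]
  rw [h2]
  exact L'.mul_mem_left _ h1

theorem isNoetherianRing [IsNoetherianRing R] : IsNoetherianRing Q := by
  rw [isNoetherianRing_iff, isNoetherian_iff']
  exact (OrderEmbedding.ofMapLEIff (fun L : Ideal Q => L.comap ι)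
    fun L L' => ⟨hι.ideal_le_of_comap_le, fun h => Ideal.comap_mono h⟩).wellFoundedGT

theorem eq_top_of_comap_isEssential [IsNoetherianRing R] [IsNoetherianRing Rᵐᵒᵖ]
    (hR : IsPrimeRing R) {L : Ideal Q} (hL : (L.comap ι).IsEssential) : L = ⊤ := by
  obtain ⟨c, hc, hc'⟩ := hR.exists_mem_nonZeroDivisors hL
  exact L.eq_top_of_isUnit_mem hc (hι.isUnit c hc')

theorem eq_top_of_isEssential [IsNoetherianRing R] [IsNoetherianRing Rᵐᵒᵖ]
    (hR : IsPrimeRing R) {L : Ideal Q} (hL : L.IsEssential) : L = ⊤ := by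
  refine hι.eq_top_of_comap_isEssential hR fun x hx => ?_
  obtain ⟨q, hq, hqL⟩ := hL (ι x) ((map_ne_zero_iff ι hι.injective).2 hx)
  obtain ⟨s, hs, r, hr⟩ := hι.surj q
  have h : ι (r * x) = ι s * (q * ι x) := by rw [map_mul, ← hr, mul_assoc]
  refine ⟨r, fun h0 => hq ?_, ?_⟩
  · rw [h0, map_zero] at h
    exact (hι.isUnit s hs).mul_right_eq_zero.1 h.symm
  · rw [Ideal.mem_comap, h]
    exact L.mul_mem_left _ hqL

/-- A nonzero two-sided ideal contains a numerator `r ≠ 0`. By primeness each `x ≠ 0` has some `r t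
x ≠ 0`, so the contraction to `R` is essential. -/
theorem isSimpleRing [IsNoetherianRing R] [IsNoetherianRing Rᵐᵒᵖ] (hR : IsPrimeRing R) :
    IsSimpleRing Q := by
  have := hR.1
  have := hι.injective.nontrivial
  refine ⟨⟨fun I => or_iff_not_imp_left.2 fun hI => ?_⟩⟩
  obtain ⟨q, hq, hq0⟩ : ∃ q ∈ I, q ≠ 0 := by
    by_contra! h
    exact hI (le_bot_iff.1 fun x hx => (TwoSidedIdeal.mem_bot Q).2 (h x hx))
  obtain ⟨s, hs, r, hr⟩ := hι.surj q
  have hrI : ι r ∈ I := by rw [← hr]; exact I.mul_mem_left _ _ hq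
  have hr0 : r ≠ 0 := by
    rintro rfl
    rw [map_zero] at hr
    exact hq0 ((hι.isUnit s hs).mul_right_eq_zero.1 hr)
  have htop := hι.eq_top_of_comap_isEssential hR (L := I.asIdeal) fun x hx => by
    have : ∃ t, r * t * x ≠ 0 := by
      by_contra! h
      exact (hR.2 r x h).elim hr0 hx
    obtain ⟨t, ht⟩ := this
    refine ⟨r * t, ht, ?_⟩
    rw [Ideal.mem_comap, TwoSidedIdeal.mem_asIdeal, map_mul, map_mul]
    exact I.mul_mem_right _ _ (I.mul_mem_right _ _ hrI)
  refine top_le_iff.1 fun x _ => ?_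
  rw [← TwoSidedIdeal.mem_asIdeal, htop]
  trivial

theorem isSemisimpleRing [IsNoetherianRing R] [IsNoetherianRing Rᵐᵒᵖ] (hR : IsPrimeRing R) :
    IsSemisimpleRing Q := by
  have hN := hι.isNoetherianRing
  refine { exists_isCompl := fun L => ?_ }
  -- For `K` maximal among left ideals disjoint from `L`, the sum `L ⊔ K` is essential, hence
  -- everything.
  obtain ⟨K, hK, hmax⟩ := set_has_maximal_iff_noetherian.2 hN {K : Ideal Q | Disjoint L K}
    ⟨⊥, disjoint_bot_right⟩
  refine ⟨K, hK, codisjoint_iff.2 (hι.eq_top_of_isEssential hR fun x hx => ?_)⟩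
  by_contra! h
  refine hmax (K ⊔ Ideal.span {x}) ?_ (lt_of_le_not_ge le_sup_left fun hge => ?_)
  · refine Submodule.disjoint_def.2 fun y hy hy' => ?_
    obtain ⟨k, hk, z, hz, rfl⟩ := Submodule.mem_sup.1 hy'
    obtain ⟨r, rfl⟩ := Ideal.mem_span_singleton'.1 hz
    have hrx : r * x = 0 := by
      by_contra hne
      refine h r hne ?_
      have : r * x = (k + r * x) + -k := by abel
      rw [this]
      exact Submodule.add_mem_sup hy (K.neg_mem hk)
    rw [hrx, add_zero] at hy ⊢
    exact Submodule.disjoint_def.1 hK k hy hk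
  · have hxK : x ∈ K := hge (Ideal.mem_sup_right (Ideal.mem_span_singleton_self x))
    exact h 1 (by simpa) (by simpa using Ideal.mem_sup_right hxK)

/-- A star ring structure on `R` induces at most one compatible structure on `Q`. -/
theorem starRing_ext [StarRing R] {S S' : StarRing Q}
    (hS : ∀ r, S.star (ι r) = ι (star r)) (hS' : ∀ r, S'.star (ι r) = ι (star r)) : S = S' := by
  have h := hι.ringHom_ext (f := (@starRingEquiv Q _ S).toRingHom)
    (g := (@starRingEquiv Q _ S').toRingHom)
    fun r => congrArg MulOpposite.op ((hS r).trans (hS' r).symm)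
  have hstar : S.star = S'.star :=
    funext fun q => congrArg MulOpposite.unop (DFunLike.congr_fun h q)
  cases S with | @mk T _ => cases T with | @mk T _ => cases T with | @mk T _ =>
  cases S' with | @mk T' _ => cases T' with | @mk T' _ => cases T' with | @mk T' _ =>
  cases T
  cases T'
  cases hstar
  rfl

end IsLeftQuotientMap

/-- The involution of `R` extends to the ring of fractions at its regular elements. -/
theorem OreLocalization.exists_starRing (R : Type*) [Ring R] [StarRing R]
    [OreLocalization.OreSet (nonZeroDivisors R)]
    (hstar : ∀ s ∈ nonZeroDivisors R, star s ∈ nonZeroDivisors R) :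
    ∃ S : StarRing (OreLocalization (nonZeroDivisors R) R), ∀ r : R,
      S.star (OreLocalization.numeratorHom r) = OreLocalization.numeratorHom (star r) := by
  have hι := OreLocalization.isLeftQuotientMap R
  let ι := OreLocalization.numeratorRingHom (R := R) (S := nonZeroDivisors R)
  -- An involution is a homomorphism to the opposite ring, so the universal property extends it;
  -- involutivity is checked on numerators.
  let f : R →+* (OreLocalization (nonZeroDivisors R) R)ᵐᵒᵖ :=
    (RingHom.op ι).comp (starRingEquiv (R := R)).toRingHom
  have hf (s : nonZeroDivisors R) : IsUnit (f s) :=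
    (hι.isUnit _ (hstar s s.2)).op
  let g := OreLocalization.universalHom f (IsUnit.liftRight (f.toMonoidHom.comp
    (nonZeroDivisors R).subtype) hf) fun _ => rfl
  have hg (r : R) : g (ι r) = MulOpposite.op (ι (star r)) :=
    OreLocalization.universalHom_commutes f _ _
  have hgg : (RingEquiv.opOp _).symm.toRingHom.comp ((RingHom.op g).comp g) = RingHom.id _ :=
    hι.ringHom_ext fun r => by
      change (g (g (ι r)).unop).unop = ι r
      rw [hg, MulOpposite.unop_op, hg, MulOpposite.unop_op, star_star]
  exact ⟨{ star := fun q => (g q).unop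
           star_involutive := DFunLike.congr_fun hgg
           star_mul := fun x y => by rw [map_mul]; rfl
           star_add := fun x y => by rw [map_add]; rfl },
    fun r => congrArg MulOpposite.unop (hg r)⟩

/-- In the ring of fractions of a real `*`-ring, `-1` is not a hermitian square. -/
theorem IsLeftQuotientMap.mul_star_self_ne_neg_one [Nontrivial R] [StarRing R] [StarRing Q]
    {ι : R →+* Q} (hι : IsLeftQuotientMap ι) (hstar : ∀ r, star (ι r) = ι (star r))
    (hreal : IsRealStarRing R) (q : Q) : q * star q ≠ -1 := by
  intro h
  obtain ⟨s, hs, r, hr⟩ := hι.surj q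
  -- With `r = s q`, one gets `r r* = s q q* s* = -s s*`.
  have h1 : s * star s + r * star r = 0 := by
    apply hι.injective
    rw [map_add, map_mul, map_mul, ← hstar, ← hstar, ← hr, star_mul, map_zero]
    rw [mul_assoc, ← mul_assoc q, h]
    simp
  have h2 := hs.1 _ (hreal.mul_star_self_eq_zero h1)
  have h3 : s = 0 := star_eq_zero.1 h2
  exact one_ne_zero (hs.1 1 (by rw [h3, zero_mul]))

end Fractions

/-- In an exchange ring, `-1` is a hermitian square. -/
theorem ExchangeRing.exists_mul_star_self_eq_neg_one (A : Type*) [Ring A] :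
    ∃ q : ExchangeRing A, q * star q = -1 :=
  ⟨((1 : A), (-1 : Aᵐᵒᵖ)), Prod.ext
    (show (1 : A) * (-1 : Aᵐᵒᵖ).unop = -1 by simp)
    (show (-1 : Aᵐᵒᵖ) * MulOpposite.op 1 = -1 by simp)⟩

theorem mainTheorem7 (R : Type u) [Ring R] [StarRing R] [IsNoetherianRing R]
    (hprime : IsStarPrimeRing R) (hreal : IsRealStarRing R) :
    -- the non-zero-divisors form a `*`-invariant two-sided Ore set
    (∀ s ∈ nonZeroDivisors R, star s ∈ nonZeroDivisors R) ∧
    (∀ (r : R) (s : nonZeroDivisors R), ∃ (r' : R) (s' : nonZeroDivisors R),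
      r * (s' : R) = (s : R) * r') ∧
    ∃ _ : OreLocalization.OreSet (nonZeroDivisors R),
      -- the ring of fractions is a matrix ring over a skew field
      (∃ (n : ℕ) (D : Type u) (_ : DivisionRing D), 0 < n ∧
        Nonempty (OreLocalization (nonZeroDivisors R) R ≃+* Matrix (Fin n) (Fin n) D)) ∧
      -- with the unique involution extending that of `R`, it is not of exchange type
      ∃ S : StarRing (OreLocalization (nonZeroDivisors R) R),
        (∀ r : R, star (OreLocalization.numeratorHom r : OreLocalization (nonZeroDivisors R) R) =
          OreLocalization.numeratorHom (star r)) ∧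
        (∀ S' : StarRing (OreLocalization (nonZeroDivisors R) R),
          (∀ r : R, S'.star (OreLocalization.numeratorHom r) =
            OreLocalization.numeratorHom (star r)) → S' = S) ∧
        ∀ (m : ℕ) (E : Type v) [DivisionRing E],
          IsEmpty (OreLocalization (nonZeroDivisors R) R ≃⋆+*
            ExchangeRing (Matrix (Fin m) (Fin m) E)) := by
  have hR : IsPrimeRing R := hprime.isPrimeRing hreal
  have := hR.1
  have : IsNoetherianRing Rᵐᵒᵖ := isNoetherianRing_of_ringEquiv R (starRingEquiv (R := R))
  have hstar : ∀ s ∈ nonZeroDivisors R, star s ∈ nonZeroDivisors R := fun s hs =>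
    ⟨fun x hx => star_eq_zero.1 (hs.2 _ (by simpa using congrArg star hx)),
      fun x hx => star_eq_zero.1 (hs.1 _ (by simpa using congrArg star hx))⟩
  refine ⟨hstar, fun r s => ?_, ?_⟩
  · obtain ⟨r', s', h⟩ := hR.exists_mul_eq_mul (star r) ⟨star (s : R), hstar s s.2⟩
    exact ⟨star r', ⟨star (s' : R), hstar s' s'.2⟩, by simpa using congrArg star h⟩
  obtain ⟨hore⟩ := hR.nonempty_oreSet
  have hι := OreLocalization.isLeftQuotientMap R
  refine ⟨hore, ?_, ?_⟩
  · have := hι.isSimpleRing hR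
    have := hι.isSemisimpleRing hR
    obtain ⟨n, hn, D, hD, he⟩ := IsSimpleRing.exists_ringEquiv_matrix_divisionRing
      (OreLocalization (nonZeroDivisors R) R)
    exact ⟨n, D, hD, Nat.pos_of_ne_zero hn.out, he⟩
  · obtain ⟨S, hS⟩ := OreLocalization.exists_starRing R hstar
    refine ⟨S, hS, fun S' hS' => hι.starRing_ext hS' hS, fun m E _ => ⟨fun e => ?_⟩⟩
    obtain ⟨q, hq⟩ := ExchangeRing.exists_mul_star_self_eq_neg_one (Matrix (Fin m) (Fin m) E)
    refine hι.mul_star_self_ne_neg_one hS hreal (e.symm q) ?_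
    rw [← map_star, ← map_mul, hq, map_neg, map_one]
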